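/- Let $M>0$, $\delta>0$, and let $f\in C^2(\mathbb R)$ satisfy $f''\ge\delta$ on $[-M,M]$; let $L_f$ be a Lipschitz constant of $f$ on $[-M,M]$. The Godunov flux of $f$ is $$g^f(p,q)=\begin{cases}\min_{x\in[p,q]}f(x)&\text{if }p\le q,\\ \max_{x\in[q,p]}f(x)&\text{if }p\ge q.\end{cases}$$ Let $\Delta_k=(\Delta t_k,\Delta x_k)$, $k\in\mathbb N$, be a sequence of pairs of positive numbers such that, for every $k$, $$\frac{\Delta x_k}{\Delta t_k}\ge 2L_f\qquad\text{and}\qquad \frac{\Delta t_k}{\Delta x_k}\,\frac{\delta}{2}\,M\le 1 .$$ For every $k$ let $(q^{n}_{j+1/2})_{n,j\ge0}$ (depending on $k$) be real numbers with $|q^n_{j+1/2}|\le M$ for all $n,j\ge 0$ which satisfy the Godunov scheme $$q^{n+1}_{j+\frac12}=q^n_{j+\frac12}-\frac{\Delta t_k}{\Delta x_k}\Big(g^f(q^n_{j+\frac12},q^n_{j+\frac32})-g^f(q^n_{j-\frac12},q^n_{j+\frac12})\Big)\qquad\text{for all } n\ge0,\ j\ge1,$$ the boundary values $q^n_{1/2}$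 and the initial values $q^0_{j+1/2}$ being otherwise arbitrary. Set $$q_{\Delta_k}(t,x)=\sum_{n\ge0}\sum_{j\ge1}q^n_{j+\frac12}\,\mathbf 1_{[n\Delta t_k,(n+1)\Delta t_k)\times[j\Delta x_k,(j+1)\Delta x_k)}(t,x).$$ Then there exist a function $\rho\in L^\infty((0,+\infty)\times(0,+\infty))$ and a subsequence of $(q_{\Delta_k})_k$ that converges to $\rho$ almost everywhere on $(0,+\infty)\times(0,+\infty)$. -/

import Mathlib

open MeasureTheory Filter Topology Set
open scoped NNReal ENNReal

noncomputable section

/-- The Godunov flux of `f`: the minimum of `f` over `[p, q]` if `p ≤ q`, and the maximum of `f`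
over `[q, p]` if `q ≤ p` (for continuous `f` the extrema are attained; for `p = q` both
expressions are `f p`). -/
def godunovFlux (f : ℝ → ℝ) (p q : ℝ) : ℝ :=
  if p ≤ q then sInf (f '' Icc p q) else sSup (f '' Icc q p)

/-- `q n j` stands for `q^n_{j+1/2}`, with `n, j ≥ 0`. The array solves the explicit Godunov scheme
with time step `Δt` and space step `Δx` in all the cells with index `≥ 1`; the equation below is
the one of the cell with index `j + 1`. The boundary values `q n 0` and the initial values `q 0 j`
are free. -/
def IsGodunovSolution (f : ℝ → ℝ) (Δt Δx : ℝ) (q : ℕ → ℕ → ℝ) : Prop :=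
  ∀ n j : ℕ, q (n + 1) (j + 1) = q n (j + 1) - Δt / Δx *
    (godunovFlux f (q n (j + 1)) (q n (j + 2)) - godunovFlux f (q n j) (q n (j + 1)))

/-- The piecewise constant function of `z = (t, x)` that equals `q n j` on the cell
`[n Δt, (n + 1) Δt) × [j Δx, (j + 1) Δx)` for `n ≥ 0` and `j ≥ 1`, and vanishes outside the union
of these cells (for `Δt, Δx > 0`). -/
def stepFunction (Δt Δx : ℝ) (q : ℕ → ℕ → ℝ) (z : ℝ × ℝ) : ℝ :=
  if 0 ≤ z.1 ∧ Δx ≤ z.2 then q ⌊z.1 / Δt⌋₊ ⌊z.2 / Δx⌋₊ else 0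

end

/-!
Write `f = max f⁺ f⁻` with `f⁺` increasing and `f⁻` decreasing; then the Godunov flux of `f` at
`(p, q)` is `max (f⁺ p) (f⁻ q)`. Strong convexity of `f` makes the second difference of the fluxes
at three neighbouring interfaces at least a quadratic in the jump between the cells, so the update
contracts positive jumps like the equation `y' = -c y²`, up to an error from the variation of the
bound between neighbouring cells. A barrier of the form `A / t + B / x` absorbs this error, and
dominates every initial and boundary jump once `t` or `x` is of the order of one step: this is
Oleinik's estimate `∂ₓq ≤ A / t + B / x`, uniformly in the step sizes.

The cell values are the space increments of a potential on the grid whose time increments are the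
fluxes. Its extensions to the plane are uniformly Lipschitz, hence converge locally uniformly along
a subsequence. When the steps tend to `0`, the one-sided bound turns the convergence of primitives
into convergence of the solutions wherever the limit is differentiable, which is almost everywhere
by Rademacher's theorem. When they do not, either `Δx → ∞` and the step functions vanish on any
given bounded set, or `Δx` has a positive limit and each cell value is a difference quotient of the
potentials.
-/

/-! ### Strongly convex functions of one variable -/

section StrongConvexity

theorem strongConvexOn_of_le_deriv2 {f : ℝ → ℝ} {s : Set ℝ} {δ : ℝ} (hs : Convex ℝ s)
    (hf : ContDiff ℝ 2 f) (hδ : ∀ x ∈ s, δ ≤ deriv (deriv f) x) : StrongConvexOn s δ f := by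
  have hf₁ : Differentiable ℝ f := hf.differentiable (by norm_num)
  have hf₂ : Differentiable ℝ (deriv f) := hf.differentiable_deriv_two
  have hd₁ (x : ℝ) : HasDerivAt (fun y => f y - δ / 2 * y ^ 2) (deriv f x - δ * x) x :=
    ((hf₁ x).hasDerivAt.sub ((hasDerivAt_pow 2 x).const_mul (δ / 2))).congr_deriv
      (by push_cast; ring)
  have hd₂ (x : ℝ) : HasDerivAt (fun y => deriv f y - δ * y) (deriv (deriv f) x - δ) x :=
    ((hf₂ x).hasDerivAt.sub ((hasDerivAt_id x).const_mul δ)).congr_deriv (by ring)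
  have hd : deriv (fun y => f y - δ / 2 * y ^ 2) = fun y => deriv f y - δ * y :=
    funext fun x => (hd₁ x).deriv
  simp only [strongConvexOn_iff_convex, Real.norm_eq_abs, sq_abs]
  refine convexOn_of_deriv2_nonneg' hs (fun x _ => (hd₁ x).differentiableAt.differentiableWithinAt)
    (hd ▸ fun x _ => (hd₂ x).differentiableAt.differentiableWithinAt) fun x hx => ?_
  simpa only [Function.iterate_succ, Function.iterate_zero, Function.comp_apply, id, hd,
    (hd₂ x).deriv, sub_nonneg] using hδ x hx

theorem mul_norm_sub_sq_le_add_sub_midpoint {E : Type*} [NormedAddCommGroup E] [NormedSpace ℝ E]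
    {f : E → ℝ} {s : Set E} {δ : ℝ} (hf : StrongConvexOn s δ f) {x y : E} (hx : x ∈ s)
    (hy : y ∈ s) : δ / 4 * ‖x - y‖ ^ 2 ≤ f x + f y - 2 * f (midpoint ℝ x y) := by
  have h := hf.2 hx hy (by norm_num : (0 : ℝ) ≤ 2⁻¹) (by norm_num : (0 : ℝ) ≤ 2⁻¹) (by norm_num)
  rw [← smul_add, ← invOf_eq_inv, ← midpoint_eq_smul_add] at h
  simp only [smul_eq_mul, invOf_eq_inv] at h
  linarith

theorem monotoneOn_inter_Ici_of_isMinOn {f : ℝ → ℝ} {s : Set ℝ} {θ : ℝ} (hf : ConvexOn ℝ s f)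
    (hθ : θ ∈ s) (hmin : IsMinOn f s θ) : MonotoneOn f (s ∩ Ici θ) := fun _x hx _y hy hxy =>
  (hf.le_max_of_mem_Icc hθ hy.1 ⟨hx.2, hxy⟩).trans (max_le (hmin hy.1) le_rfl)

theorem antitoneOn_inter_Iic_of_isMinOn {f : ℝ → ℝ} {s : Set ℝ} {θ : ℝ} (hf : ConvexOn ℝ s f)
    (hθ : θ ∈ s) (hmin : IsMinOn f s θ) : AntitoneOn f (s ∩ Iic θ) := fun _x hx _y hy hxy =>
  (hf.le_max_of_mem_Icc hx.1 hθ ⟨hxy, hy.2⟩).trans (max_le le_rfl (hmin hx.1))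

end StrongConvexity

/-! ### The Godunov flux and Oleinik's estimate -/

/-- Unimodality of `f` on `[a, b]` with minimum point `θ`, the shape of `f` for which the Godunov
flux splits into an increasing and a decreasing part. Monotonicity is meant in the weak sense. -/
structure IsUnimodalOn (f : ℝ → ℝ) (a b θ : ℝ) : Prop where
  mem : θ ∈ Icc a b
  antitoneOn : AntitoneOn f (Icc a θ)
  monotoneOn : MonotoneOn f (Icc θ b)

/-- The increasing part `f⁺` of a function `f` that is unimodal with minimum point `θ`, extended to
the left of `θ` by the minimum value. -/
def risingPart (f : ℝ → ℝ) (θ x : ℝ) : ℝ := f (max x θ)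

/-- The decreasing part `f⁻` of a function `f` that is unimodal with minimum point `θ`, extended to
the right of `θ` by the minimum value. -/
def fallingPart (f : ℝ → ℝ) (θ x : ℝ) : ℝ := f (min x θ)

theorem risingPart_of_le {f : ℝ → ℝ} {θ x : ℝ} (hx : θ ≤ x) : risingPart f θ x = f x := by
  rw [risingPart, max_eq_left hx]

theorem risingPart_of_ge {f : ℝ → ℝ} {θ x : ℝ} (hx : x ≤ θ) : risingPart f θ x = f θ := by
  rw [risingPart, max_eq_right hx]

theorem fallingPart_of_le {f : ℝ → ℝ} {θ x : ℝ} (hx : θ ≤ x) : fallingPart f θ x = f θ := by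
  rw [fallingPart, min_eq_right hx]

theorem fallingPart_of_ge {f : ℝ → ℝ} {θ x : ℝ} (hx : x ≤ θ) : fallingPart f θ x = f x := by
  rw [fallingPart, min_eq_left hx]

namespace IsUnimodalOn

variable {f : ℝ → ℝ} {a b θ p q x y : ℝ}

theorem risingPart_le_risingPart (h : IsUnimodalOn f a b θ) (hxy : x ≤ y) (hy : y ≤ b) :
    risingPart f θ x ≤ risingPart f θ y :=
  h.monotoneOn ⟨le_max_right _ _, max_le (hxy.trans hy) h.mem.2⟩
    ⟨le_max_right _ _, max_le hy h.mem.2⟩ (max_le_max_right θ hxy)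

theorem fallingPart_le_fallingPart (h : IsUnimodalOn f a b θ) (hxy : x ≤ y) (hx : a ≤ x) :
    fallingPart f θ y ≤ fallingPart f θ x :=
  h.antitoneOn ⟨le_min hx h.mem.1, min_le_right _ _⟩
    ⟨le_min (hx.trans hxy) h.mem.1, min_le_right _ _⟩ (min_le_min_right θ hxy)

theorem apply_min_le (h : IsUnimodalOn f a b θ) (hx : x ∈ Icc a b) : f θ ≤ f x := by
  rcases le_total θ x with hθx | hxθ
  · exact h.monotoneOn ⟨le_rfl, h.mem.2⟩ ⟨hθx, hx.2⟩ hθx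
  · exact h.antitoneOn ⟨hx.1, hxθ⟩ ⟨h.mem.1, le_rfl⟩ hxθ

theorem max_risingPart_fallingPart (h : IsUnimodalOn f a b θ) (hx : x ∈ Icc a b) :
    max (risingPart f θ x) (fallingPart f θ x) = f x := by
  rcases le_total θ x with hθx | hxθ
  · rw [risingPart_of_le hθx, fallingPart_of_le hθx, max_eq_left (h.apply_min_le hx)]
  · rw [risingPart_of_ge hxθ, fallingPart_of_ge hxθ, max_eq_right (h.apply_min_le hx)]

theorem isLeast_image_Icc (h : IsUnimodalOn f a b θ) (hp : p ∈ Icc a b) (hq : q ∈ Icc a b)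
    (hpq : p ≤ q) : IsLeast (f '' Icc p q) (max (risingPart f θ p) (fallingPart f θ q)) := by
  constructor
  · rcases le_total θ p with hθp | hpθ
    · refine ⟨p, left_mem_Icc.2 hpq, ?_⟩
      rw [risingPart_of_le hθp, fallingPart_of_le (hθp.trans hpq), max_eq_left (h.apply_min_le hp)]
    rcases le_total θ q with hθq | hqθ
    · refine ⟨θ, ⟨hpθ, hθq⟩, ?_⟩
      rw [risingPart_of_ge hpθ, fallingPart_of_le hθq, max_self]
    · refine ⟨q, right_mem_Icc.2 hpq, ?_⟩
      rw [risingPart_of_ge hpθ, fallingPart_of_ge hqθ, max_eq_right (h.apply_min_le hq)]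
  · rintro _ ⟨y, hy, rfl⟩
    rw [← h.max_risingPart_fallingPart ⟨hp.1.trans hy.1, hy.2.trans hq.2⟩]
    exact max_le_max (h.risingPart_le_risingPart hy.1 (hy.2.trans hq.2))
      (h.fallingPart_le_fallingPart hy.2 (hp.1.trans hy.1))

theorem isGreatest_image_Icc (h : IsUnimodalOn f a b θ) (hp : p ∈ Icc a b) (hq : q ∈ Icc a b)
    (hqp : q ≤ p) : IsGreatest (f '' Icc q p) (max (risingPart f θ p) (fallingPart f θ q)) := by
  have hp_mem : f p ∈ f '' Icc q p := mem_image_of_mem f (right_mem_Icc.2 hqp)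
  have hq_mem : f q ∈ f '' Icc q p := mem_image_of_mem f (left_mem_Icc.2 hqp)
  constructor
  · rcases le_total θ q with hθq | hqθ
    · rwa [risingPart_of_le (hθq.trans hqp), fallingPart_of_le hθq,
        max_eq_left (h.apply_min_le hp)]
    rcases le_total θ p with hθp | hpθ
    · rw [risingPart_of_le hθp, fallingPart_of_ge hqθ]
      rcases max_choice (f p) (f q) with hmax | hmax <;> rwa [hmax]
    · rwa [risingPart_of_ge hpθ, fallingPart_of_ge hqθ, max_eq_right (h.apply_min_le hq)]
  · rintro _ ⟨y, hy, rfl⟩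
    rw [← h.max_risingPart_fallingPart ⟨hq.1.trans hy.1, hy.2.trans hp.2⟩]
    exact max_le_max (h.risingPart_le_risingPart hy.2 hp.2) (h.fallingPart_le_fallingPart hy.1 hq.1)

theorem godunovFlux_eq_max (h : IsUnimodalOn f a b θ) (hp : p ∈ Icc a b) (hq : q ∈ Icc a b) :
    godunovFlux f p q = max (risingPart f θ p) (fallingPart f θ q) := by
  rw [godunovFlux]
  split_ifs with hpq
  · exact (h.isLeast_image_Icc hp hq hpq).csInf_eq
  · exact (h.isGreatest_image_Icc hp hq (not_le.1 hpq).le).csSup_eq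

theorem abs_godunovFlux_le (h : IsUnimodalOn f a b θ) {F : ℝ} (hF : ∀ x ∈ Icc a b, |f x| ≤ F)
    (hp : p ∈ Icc a b) (hq : q ∈ Icc a b) : |godunovFlux f p q| ≤ F := by
  rw [h.godunovFlux_eq_max hp hq]
  exact abs_max_le_max_abs_abs.trans <| max_le
    (hF _ ⟨h.mem.1.trans (le_max_right _ _), max_le hp.2 h.mem.2⟩)
    (hF _ ⟨le_min hq.1 h.mem.1, (min_le_right _ _).trans h.mem.2⟩)

end IsUnimodalOn

theorem godunovFlux_comp_neg (f : ℝ → ℝ) (p q : ℝ) :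
    godunovFlux (fun x => f (-x)) (-q) (-p) = godunovFlux f p q := by
  have himage (u v : ℝ) : (fun x => f (-x)) '' Icc (-v) (-u) = f '' Icc u v := by
    rw [← image_neg_Icc, image_image]
    simp only [neg_neg]
  simp only [godunovFlux, neg_le_neg_iff, himage]

/-- The fluxes for which Oleinik's estimate is proved: `f` is `δ`-strongly convex with `δ > 0` and
`L`-Lipschitz on `[a, b]`, and `θ` is its minimum point there. -/
structure IsStronglyConvexFlux (f : ℝ → ℝ) (a b δ : ℝ) (L : ℝ≥0) (θ : ℝ) : Prop where
  pos : 0 < δ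
  strongConvexOn : StrongConvexOn (Icc a b) δ f
  lipschitzOn : LipschitzOnWith L f (Icc a b)
  mem : θ ∈ Icc a b
  isMinOn : IsMinOn f (Icc a b) θ

theorem exists_isStronglyConvexFlux {f : ℝ → ℝ} {a b δ : ℝ} {L : ℝ≥0} (hab : a ≤ b) (hδ : 0 < δ)
    (hf : StrongConvexOn (Icc a b) δ f) (hL : LipschitzOnWith L f (Icc a b)) :
    ∃ θ, IsStronglyConvexFlux f a b δ L θ := by
  obtain ⟨θ, hθ, hmin⟩ := isCompact_Icc.exists_isMinOn (nonempty_Icc.2 hab) hL.continuousOn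
  exact ⟨θ, hδ, hf, hL, hθ, hmin⟩

namespace IsStronglyConvexFlux

variable {f : ℝ → ℝ} {a b δ θ x y : ℝ} {L : ℝ≥0}

theorem isUnimodalOn (h : IsStronglyConvexFlux f a b δ L θ) : IsUnimodalOn f a b θ := by
  have hconv : ConvexOn ℝ (Icc a b) f :=
    (h.strongConvexOn.strictConvexOn h.pos).convexOn
  exact ⟨h.mem,
    (antitoneOn_inter_Iic_of_isMinOn hconv h.mem h.isMinOn).mono fun _ hx =>
      ⟨⟨hx.1, hx.2.trans h.mem.2⟩, hx.2⟩,
    (monotoneOn_inter_Ici_of_isMinOn hconv h.mem h.isMinOn).mono fun _ hx =>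
      ⟨⟨h.mem.1.trans hx.1, hx.2⟩, hx.1⟩⟩

theorem comp_neg (h : IsStronglyConvexFlux f a b δ L θ) :
    IsStronglyConvexFlux (fun x => f (-x)) (-b) (-a) δ L (-θ) := by
  have hmaps : MapsTo Neg.neg (Icc (-b) (-a)) (Icc a b) := fun x hx =>
    ⟨le_neg.2 hx.2, neg_le.2 hx.1⟩
  refine ⟨h.pos, ⟨convex_Icc _ _, fun x hx y hy s t hs ht hst => ?_⟩, ?_,
    ⟨neg_le_neg h.mem.2, neg_le_neg h.mem.1⟩, fun x hx => ?_⟩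
  · have hnorm : ‖-x - -y‖ = ‖x - y‖ := by rw [neg_sub_neg, norm_sub_rev]
    simpa only [hnorm, smul_neg, ← neg_add] using
      h.strongConvexOn.2 (hmaps hx) (hmaps hy) hs ht hst
  · refine LipschitzOnWith.of_dist_le_mul fun x hx y hy => ?_
    simpa only [dist_neg_neg] using h.lipschitzOn.dist_le_mul _ (hmaps hx) _ (hmaps hy)
  · simpa only [neg_neg, mem_ofPred_eq] using isMinOn_iff.1 h.isMinOn _ (hmaps hx)

theorem mul_sub_sq_le_add_sub_midpoint (h : IsStronglyConvexFlux f a b δ L θ)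
    (hx : x ∈ Icc a b) (hy : y ∈ Icc a b) :
    δ / 4 * (x - y) ^ 2 ≤ f x + f y - 2 * f ((x + y) / 2) := by
  have hmid : midpoint ℝ x y = (x + y) / 2 := by
    rw [midpoint_eq_smul_add, invOf_eq_inv, smul_eq_mul, inv_mul_eq_div]
  simpa only [hmid, Real.norm_eq_abs, sq_abs] using
    mul_norm_sub_sq_le_add_sub_midpoint h.strongConvexOn hx hy

theorem sub_le_mul_abs_sub (h : IsStronglyConvexFlux f a b δ L θ) (hx : x ∈ Icc a b)
    (hy : y ∈ Icc a b) : f x - f y ≤ L * |x - y| :=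
  (le_abs_self _).trans (h.lipschitzOn.dist_le_mul x hx y hy)

theorem mul_sub_le_four_mul (h : IsStronglyConvexFlux f a b δ L θ) : δ * (b - a) ≤ 4 * L := by
  rcases (h.mem.1.trans h.mem.2).eq_or_lt with rfl | hab
  · simp
  have ha : a ∈ Icc a b := left_mem_Icc.2 hab.le
  have hb : b ∈ Icc a b := right_mem_Icc.2 hab.le
  have hmid : (a + b) / 2 ∈ Icc a b := ⟨by linarith, by linarith⟩
  have hconv := h.mul_sub_sq_le_add_sub_midpoint ha hb
  have hleft := h.sub_le_mul_abs_sub ha hmid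
  have hright := h.sub_le_mul_abs_sub hb hmid
  rw [abs_of_nonpos (by linarith)] at hleft
  rw [abs_of_nonneg (by linarith)] at hright
  refine le_of_mul_le_mul_right ?_ (sub_pos.2 hab)
  linarith

theorem mul_sq_le_sub (h : IsStronglyConvexFlux f a b δ L θ) (hθx : θ ≤ x) (hxy : x ≤ y)
    (hyb : y ≤ b) : δ / 4 * (x - y) ^ 2 ≤ f y - f x := by
  have hmono : f x ≤ f ((x + y) / 2) :=
    h.isUnimodalOn.monotoneOn ⟨hθx, hxy.trans hyb⟩ ⟨by linarith, by linarith⟩ (by linarith)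
  have hconv := h.mul_sub_sq_le_add_sub_midpoint (x := x) (y := y)
    ⟨h.mem.1.trans hθx, hxy.trans hyb⟩ ⟨h.mem.1.trans (hθx.trans hxy), hyb⟩
  linarith

theorem risingPart_sub_le (h : IsStronglyConvexFlux f a b δ L θ) {d : ℝ} (hd : 0 ≤ d) (hx : x ≤ b)
    (hy : y ≤ b) (hxy : x - y ≤ d) : risingPart f θ x - risingPart f θ y ≤ L * d := by
  rcases le_total x y with hle | hle
  · exact (sub_nonpos.2 (h.isUnimodalOn.risingPart_le_risingPart hle hy)).trans
      (mul_nonneg L.coe_nonneg hd)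
  · calc risingPart f θ x - risingPart f θ y
        ≤ L * |max x θ - max y θ| := h.sub_le_mul_abs_sub
          ⟨h.mem.1.trans (le_max_right _ _), max_le hx h.mem.2⟩
          ⟨h.mem.1.trans (le_max_right _ _), max_le hy h.mem.2⟩
      _ ≤ L * |x - y| := mul_le_mul_of_nonneg_left (abs_max_sub_max_le_abs x y θ) L.coe_nonneg
      _ ≤ L * d := by rw [abs_of_nonneg (sub_nonneg.2 hle)]; gcongr

theorem mul_sq_le_risingPart_second_difference (h : IsStronglyConvexFlux f a b δ L θ) {e : ℝ}
    (hθx : θ ≤ x) (he : 0 ≤ e) (hxe : x + e ≤ b) :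
    δ / 8 * e ^ 2 ≤ risingPart f θ (x + e) - 2 * risingPart f θ x + risingPart f θ (x - e) := by
  have ha := h.mem.1
  rw [risingPart_of_le hθx, risingPart_of_le (by linarith : θ ≤ x + e)]
  rcases le_total θ (x - e) with hθe | hθe
  · have hconv := h.mul_sub_sq_le_add_sub_midpoint (x := x + e) (y := x - e)
      ⟨by linarith, hxe⟩ ⟨by linarith, by linarith⟩
    rw [show (x + e + (x - e)) / 2 = x by ring] at hconv
    rw [risingPart_of_le hθe]
    nlinarith [h.pos, sq_nonneg e]
  · have hconv := h.mul_sub_sq_le_add_sub_midpoint (x := θ) (y := 2 * x - θ) h.mem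
      ⟨by linarith, by linarith⟩
    have hgrowth := h.mul_sq_le_sub (x := 2 * x - θ) (y := x + e) (by linarith) (by linarith) hxe
    rw [show (θ + (2 * x - θ)) / 2 = x by ring] at hconv
    rw [risingPart_of_ge hθe]
    nlinarith [mul_nonneg h.pos.le (sq_nonneg (e - 2 * (x - θ))),
      mul_nonneg h.pos.le (sq_nonneg (x - θ))]

variable {q₁ q₂ q₃ q₄ D : ℝ}

theorem flux_second_difference_ge_of_fallingPart_le_risingPart
    (h : IsStronglyConvexFlux f a b δ L θ) (h₁ : q₁ ∈ Icc a b) (h₂ : q₂ ∈ Icc a b)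
    (h₃ : q₃ ∈ Icc a b) (h₄ : q₄ ∈ Icc a b) (hD : 0 ≤ D) (h₁₂ : q₂ - q₁ ≤ D) (h₂₃ : q₃ - q₂ ≤ D)
    (hparts : fallingPart f θ q₃ ≤ risingPart f θ q₂) :
    δ / 8 * max (q₃ - q₂) 0 ^ 2 - L * (D - (q₃ - q₂)) ≤
      godunovFlux f q₃ q₄ - 2 * godunovFlux f q₂ q₃ + godunovFlux f q₁ q₂ := by
  have hf := h.isUnimodalOn
  rw [hf.godunovFlux_eq_max h₃ h₄, hf.godunovFlux_eq_max h₂ h₃, hf.godunovFlux_eq_max h₁ h₂,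
    max_eq_left hparts]
  have hr₃ := le_max_left (risingPart f θ q₃) (fallingPart f θ q₄)
  have hr₁ := le_max_left (risingPart f θ q₁) (fallingPart f θ q₂)
  rcases le_total q₃ q₂ with h₃₂ | h₂₃'
  · have hright := h.risingPart_sub_le (sub_nonneg.2 h₃₂) h₂.2 h₃.2 le_rfl
    have hleft := h.risingPart_sub_le hD h₂.2 h₁.2 h₁₂
    rw [max_eq_right (sub_nonpos.2 h₃₂)]
    linarith
  rw [max_eq_left (sub_nonneg.2 h₂₃')]
  rcases le_total θ q₂ with hθ₂ | h₂θ
  · have hsecond := h.mul_sq_le_risingPart_second_difference hθ₂ (sub_nonneg.2 h₂₃')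
      (by linarith [h₃.2])
    have hleft := h.risingPart_sub_le (x := q₂ - (q₃ - q₂)) (y := q₁) (sub_nonneg.2 h₂₃)
      (by linarith [h₂.2]) h₁.2 (by linarith)
    rw [add_sub_cancel] at hsecond
    linarith
  · have hmid := h.mul_sub_sq_le_add_sub_midpoint h₃ h₂
    have hmin : f θ ≤ f ((q₃ + q₂) / 2) :=
      hf.apply_min_le ⟨by linarith [h₂.1], by linarith [h₃.2]⟩
    have hq₃ : f q₃ ≤ risingPart f θ q₃ := (hf.max_risingPart_fallingPart h₃).symm.trans_le <|
      max_le le_rfl (hparts.trans (hf.risingPart_le_risingPart h₂₃' h₃.2))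
    have hq₂ := le_max_right (risingPart f θ q₁) (fallingPart f θ q₂)
    rw [fallingPart_of_ge h₂θ] at hq₂ hr₁ ⊢
    rw [risingPart_of_ge h₂θ]
    have hslack : 0 ≤ L * (D - (q₃ - q₂)) := mul_nonneg L.coe_nonneg (sub_nonneg.2 h₂₃)
    nlinarith [h.pos, sq_nonneg (q₃ - q₂)]

theorem flux_second_difference_ge (h : IsStronglyConvexFlux f a b δ L θ) (h₁ : q₁ ∈ Icc a b)
    (h₂ : q₂ ∈ Icc a b) (h₃ : q₃ ∈ Icc a b) (h₄ : q₄ ∈ Icc a b) (hD : 0 ≤ D) (h₁₂ : q₂ - q₁ ≤ D)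
    (h₂₃ : q₃ - q₂ ≤ D) (h₃₄ : q₄ - q₃ ≤ D) :
    δ / 8 * max (q₃ - q₂) 0 ^ 2 - L * (D - (q₃ - q₂)) ≤
      godunovFlux f q₃ q₄ - 2 * godunovFlux f q₂ q₃ + godunovFlux f q₁ q₂ := by
  rcases le_total (fallingPart f θ q₃) (risingPart f θ q₂) with hparts | hparts
  · exact h.flux_second_difference_ge_of_fallingPart_le_risingPart h₁ h₂ h₃ h₄ hD h₁₂ h₂₃ hparts
  -- The reflection `x ↦ -x` exchanges the two parts of `f` and reverses the order of the cells.
  have hneg {u : ℝ} (hu : u ∈ Icc a b) : -u ∈ Icc (-b) (-a) := ⟨neg_le_neg hu.2, neg_le_neg hu.1⟩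
  have hparts' : fallingPart (fun x => f (-x)) (-θ) (-q₂) ≤
      risingPart (fun x => f (-x)) (-θ) (-q₃) := by
    simpa only [fallingPart, risingPart, min_neg_neg, max_neg_neg, neg_neg] using hparts
  have hmirror := h.comp_neg.flux_second_difference_ge_of_fallingPart_le_risingPart
    (hneg h₄) (hneg h₃) (hneg h₂) (hneg h₁) hD (by linarith) (by linarith) hparts'
  simp only [godunovFlux_comp_neg, neg_sub_neg] at hmirror
  linarith

theorem update_sub_le (h : IsStronglyConvexFlux f a b δ L θ) {lam D' : ℝ} (hlam : 0 ≤ lam)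
    (hlamL : lam * L ≤ 1 / 2) (hlamD : lam * δ * D ≤ 4) (hD : 0 ≤ D) (hDD' : D ≤ D')
    (h₁ : q₁ ∈ Icc a b) (h₂ : q₂ ∈ Icc a b) (h₃ : q₃ ∈ Icc a b) (h₄ : q₄ ∈ Icc a b)
    (h₁₂ : q₂ - q₁ ≤ D') (h₂₃ : q₃ - q₂ ≤ D) (h₃₄ : q₄ - q₃ ≤ D') :
    q₃ - lam * (godunovFlux f q₃ q₄ - godunovFlux f q₂ q₃) -
        (q₂ - lam * (godunovFlux f q₂ q₃ - godunovFlux f q₁ q₂)) ≤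
      D + lam * (L * (D' - D)) - lam * (δ / 16) * D ^ 2 := by
  have hflux := mul_le_mul_of_nonneg_left (h.flux_second_difference_ge h₁ h₂ h₃ h₄
    (hD.trans hDD') h₁₂ (h₂₃.trans hDD') h₃₄) hlam
  suffices hquad : lam * δ / 16 * D ^ 2 ≤
      (D - (q₃ - q₂)) * (1 - lam * L) + lam * δ / 8 * max (q₃ - q₂) 0 ^ 2 by linarith
  have hhalf : (D - (q₃ - q₂)) / 2 ≤ (D - (q₃ - q₂)) * (1 - lam * L) := by nlinarith
  have hlamδ : 0 ≤ lam * δ := mul_nonneg hlam h.pos.le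
  rcases le_total (q₃ - q₂) 0 with he | he
  · rw [max_eq_right he]
    nlinarith
  · rw [max_eq_left he]
    nlinarith [mul_nonneg hlamδ (sq_nonneg (q₃ - q₂)),
      mul_nonneg hlamδ (sq_nonneg (D - (q₃ - q₂))),
      mul_le_mul_of_nonneg_right hlamD (sub_nonneg.2 h₂₃)]

end IsStronglyConvexFlux

theorem barrier_step {lam c L α β n j : ℝ} (hlam : 0 ≤ lam) (hL : 0 ≤ L) (hα : 0 ≤ α)
    (hβ : 0 ≤ β) (hlamα : lam * c * α = 1) (hLβ : 2 * L ≤ c * β) (hn : 1 ≤ n) (hj : 1 ≤ j) :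
    α / n + β / (j + 1) + lam * (L * (α / n + β / j - (α / n + β / (j + 1)))) -
      lam * c * (α / n + β / (j + 1)) ^ 2 ≤ α / (n + 1) + β / (j + 1) := by
  have htime : α / n - α / (n + 1) ≤ lam * c * (α / n) ^ 2 := calc
    α / n - α / (n + 1) = α / (n * (n + 1)) := by field_simp; ring
    _ ≤ α / (n * n) := by gcongr; linarith
    _ = lam * c * α * (α / (n * n)) := by rw [hlamα, one_mul]
    _ = lam * c * (α / n) ^ 2 := by ring
  have hspace : L * (β / j - β / (j + 1)) ≤ c * (β / (j + 1)) ^ 2 := calc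
    L * (β / j - β / (j + 1)) = 2 * L * β * (1 / (2 * j * (j + 1))) := by field_simp; ring
    _ ≤ 2 * L * β * (1 / ((j + 1) * (j + 1))) := by gcongr; linarith
    _ ≤ c * β * β * (1 / ((j + 1) * (j + 1))) := by gcongr
    _ = c * (β / (j + 1)) ^ 2 := by field_simp
  have hcross : 0 ≤ lam * c * (α / n * (β / (j + 1))) := calc
    0 ≤ lam * c * α * (β / (n * (j + 1))) := by rw [hlamα]; positivity
    _ = lam * c * (α / n * (β / (j + 1))) := by field_simp
  linarith [mul_le_mul_of_nonneg_left hspace hlam]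

/-- Oleinik's one-sided estimate `∂ₓq ≤ A / t + B / x`, for the increments of an array between
neighbouring cells of size `Δt × Δx`. -/
def HasOleinikBound (Δt Δx A B : ℝ) (q : ℕ → ℕ → ℝ) : Prop :=
  ∀ n j : ℕ, 1 ≤ n → 1 ≤ j → q n (j + 1) - q n j ≤ Δx * (A / (n * Δt) + B / (j * Δx))

namespace IsStronglyConvexFlux

variable {f : ℝ → ℝ} {a b δ θ Δt Δx α β : ℝ} {L : ℝ≥0} {q : ℕ → ℕ → ℝ}

theorem sub_le_barrier_succ (h : IsStronglyConvexFlux f a b δ L θ) (hΔt : 0 < Δt)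
    (hΔx : 0 < Δx) (hCFL : Δt / Δx * L ≤ 1 / 2) (hα : Δt / Δx * (δ / 16) * α = 1)
    (hβ : δ / 16 * β = 2 * L) (hq : IsGodunovSolution f Δt Δx q) (hmem : ∀ n j, q n j ∈ Icc a b)
    {n : ℕ} (hn : 1 ≤ n) (ih : ∀ j : ℕ, 1 ≤ j → q n (j + 1) - q n j ≤ α / n + β / j) (i : ℕ) :
    q (n + 1) (i + 3) - q (n + 1) (i + 2) ≤ α / (n + 1 : ℕ) + β / (i + 2 : ℕ) := by
  have hδ := h.pos
  have hlam : 0 < Δt / Δx := div_pos hΔt hΔx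
  have hα₀ : 0 < α := pos_of_mul_pos_right (hα ▸ one_pos) (by positivity)
  have hβ₀ : 0 ≤ β := by nlinarith [L.coe_nonneg]
  rcases le_or_gt (b - a) (α / (n + 1 : ℕ) + β / (i + 2 : ℕ)) with hsmall | hlarge
  · exact (sub_le_sub (hmem _ _).2 (hmem _ _).1).trans hsmall
  -- From here on the barrier is below `b - a`, hence small enough for `update_sub_le`.
  have hDD' : α / n + β / (i + 2 : ℕ) ≤ α / n + β / (i + 1 : ℕ) := by gcongr; norm_num
  have hD₃ : α / n + β / (i + 3 : ℕ) ≤ α / n + β / (i + 1 : ℕ) := by gcongr; norm_num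
  have hlamD : Δt / Δx * δ * (α / n + β / (i + 2 : ℕ)) ≤ 4 := by
    have hdouble : α / n ≤ 2 * (α / (n + 1 : ℕ)) := by
      rw [← mul_div_assoc, mul_comm 2 α, ← div_div_eq_mul_div]
      gcongr
      rw [div_le_iff₀ two_pos]
      exact_mod_cast (by omega : n + 1 ≤ n * 2)
    have : 0 ≤ β / (i + 2 : ℕ) := by positivity
    calc Δt / Δx * δ * (α / n + β / (i + 2 : ℕ))
        ≤ Δt / Δx * δ * (2 * (b - a)) := by gcongr; linarith
      _ = 2 * (Δt / Δx) * (δ * (b - a)) := by ring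
      _ ≤ 2 * (Δt / Δx) * (4 * L) :=
        mul_le_mul_of_nonneg_left (h.mul_sub_le_four_mul) (by positivity)
      _ ≤ 4 := by linarith
  have hstep := h.update_sub_le hlam.le hCFL hlamD (by positivity) hDD' (hmem n (i + 1))
    (hmem n (i + 2)) (hmem n (i + 3)) (hmem n (i + 4)) (ih (i + 1) (by omega))
    (ih (i + 2) (by omega)) ((ih (i + 3) (by omega)).trans hD₃)
  have hbarrier := barrier_step hlam.le L.coe_nonneg hα₀.le hβ₀ hα hβ.ge
    (n := n) (j := (i + 1 : ℕ)) (mod_cast hn) (mod_cast Nat.le_add_left 1 i)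
  rw [hq n (i + 2), hq n (i + 1)]
  push_cast at hstep hbarrier ⊢
  rw [show (i : ℝ) + 1 + 1 = i + 2 by ring] at hbarrier
  exact hstep.trans hbarrier

theorem sub_le_barrier (h : IsStronglyConvexFlux f a b δ L θ) (hΔt : 0 < Δt)
    (hΔx : 0 < Δx) (hCFL : Δt / Δx * L ≤ 1 / 2) (hα : Δt / Δx * (δ / 16) * α = 1)
    (hβ : δ / 16 * β = 2 * L) (hq : IsGodunovSolution f Δt Δx q) (hmem : ∀ n j, q n j ∈ Icc a b)
    {n : ℕ} (hn : 1 ≤ n) : ∀ j : ℕ, 1 ≤ j → q n (j + 1) - q n j ≤ α / n + β / j := by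
  have hδ := h.pos
  have hlam : 0 < Δt / Δx := div_pos hΔt hΔx
  have hab : 0 ≤ b - a := sub_nonneg.2 (h.mem.1.trans h.mem.2)
  have hwidth := h.mul_sub_le_four_mul
  have hosc (n j : ℕ) : q n (j + 1) - q n j ≤ b - a := sub_le_sub (hmem _ _).2 (hmem _ _).1
  have hα_width : b - a ≤ α := by
    refine le_of_mul_le_mul_left ?_ (mul_pos hlam hδ)
    linarith [mul_le_mul_of_nonneg_left hwidth hlam.le]
  have hβ_width : b - a ≤ β := by nlinarith
  have hα₀ : 0 ≤ α := hab.trans hα_width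
  have hβ₀ : 0 ≤ β := hab.trans hβ_width
  induction n, hn using Nat.le_induction with
  | base =>
    intro j _
    rw [Nat.cast_one, div_one]
    exact (hosc 1 j).trans (hα_width.trans (le_add_of_nonneg_right (by positivity)))
  | succ n hn ih =>
    intro j hj
    obtain rfl | ⟨i, rfl⟩ : j = 1 ∨ ∃ i, j = i + 2 := by
      rcases j with _ | _ | i
      exacts [absurd hj (by norm_num), .inl rfl, .inr ⟨i, rfl⟩]
    · rw [Nat.cast_one, div_one]
      exact (hosc (n + 1) 1).trans (hβ_width.trans (le_add_of_nonneg_left (by positivity)))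
    · exact h.sub_le_barrier_succ hΔt hΔx hCFL hα hβ hq hmem hn ih i

theorem hasOleinikBound (h : IsStronglyConvexFlux f a b δ L θ) (hΔt : 0 < Δt)
    (hΔx : 0 < Δx) (hCFL : 2 * L ≤ Δx / Δt) (hq : IsGodunovSolution f Δt Δx q)
    (hmem : ∀ n j, q n j ∈ Icc a b) : HasOleinikBound Δt Δx (16 / δ) (32 * L / δ) q := by
  intro n j hn hj
  have hδ := h.pos
  have hCFL' : Δt / Δx * L ≤ 1 / 2 := by
    rw [le_div_iff₀ hΔt] at hCFL
    rw [div_mul_eq_mul_div, div_le_iff₀ hΔx]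
    linarith
  refine (h.sub_le_barrier (α := 16 * Δx / (δ * Δt)) (β := 32 * L / δ) hΔt hΔx hCFL'
    (by field_simp) (by field_simp; ring) hq hmem hn j hj).trans_eq ?_
  have : (0 : ℝ) < j := mod_cast hj
  have : (0 : ℝ) < n := mod_cast hn
  field_simp

end IsStronglyConvexFlux

/-! ### Potentials -/

theorem dist_le_mul_abs_sub_of_dist_succ_le {E : Type*} [PseudoMetricSpace E] {u : ℕ → E} {C : ℝ}
    (hu : ∀ n, dist (u n) (u (n + 1)) ≤ C) (n m : ℕ) : dist (u n) (u m) ≤ C * |(n : ℝ) - m| := by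
  wlog hnm : n ≤ m generalizing n m
  · rw [dist_comm, abs_sub_comm]
    exact this m n (le_of_not_ge hnm)
  refine (dist_le_Ico_sum_of_dist_le hnm fun {k} _ _ => hu k).trans_eq ?_
  rw [Finset.sum_const, Nat.card_Ico, nsmul_eq_mul, mul_comm, abs_sub_comm, ← Nat.cast_sub hnm,
    Nat.abs_cast]

theorem exists_lipschitzWith_extension_of_lattice {Δt Δx : ℝ} (hΔt : 0 < Δt) (hΔx : 0 < Δx)
    {S : ℕ → ℕ → ℝ} {F M : ℝ≥0} (ht : ∀ n j, |S n j - S (n + 1) j| ≤ F * Δt)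
    (hx : ∀ n j, |S n j - S n (j + 1)| ≤ M * Δx) :
    ∃ V : ℝ × ℝ → ℝ, LipschitzWith (F + M) V ∧ ∀ n j : ℕ, V (n * Δt, j * Δx) = S n j := by
  let node : ℕ × ℕ → ℝ × ℝ := fun p => (p.1 * Δt, p.2 * Δx)
  have hnode : node.Injective := by
    rintro ⟨n, j⟩ ⟨m, i⟩ h
    simpa [node, hΔt.ne', hΔx.ne'] using h
  have hdist (n j m i : ℕ) :
      dist (node (n, j)) (node (m, i)) = max (|(n : ℝ) - m| * Δt) (|(j : ℝ) - i| * Δx) := by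
    simp only [node, Prod.dist_eq, Real.dist_eq, ← sub_mul, abs_mul, abs_of_pos hΔt, abs_of_pos hΔx]
  let S' : ℝ × ℝ → ℝ := Function.extend node (fun p => S p.1 p.2) 0
  have hS' (n j : ℕ) : S' (node (n, j)) = S n j := hnode.extend_apply _ _ (n, j)
  have hlip : LipschitzOnWith (F + M) S' (range node) := by
    refine LipschitzOnWith.of_dist_le_mul ?_
    rintro _ ⟨⟨n, j⟩, rfl⟩ _ ⟨⟨m, i⟩, rfl⟩
    rw [hS', hS', hdist, NNReal.coe_add]
    calc dist (S n j) (S m i) ≤ dist (S n j) (S m j) + dist (S m j) (S m i) := dist_triangle _ _ _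
      _ ≤ F * Δt * |(n : ℝ) - m| + M * Δx * |(j : ℝ) - i| := add_le_add
        (dist_le_mul_abs_sub_of_dist_succ_le (u := fun k => S k j) (fun k => ht k j) n m)
        (dist_le_mul_abs_sub_of_dist_succ_le (u := S m) (hx m) j i)
      _ = F * (|(n : ℝ) - m| * Δt) + M * (|(j : ℝ) - i| * Δx) := by ring
      _ ≤ (F + M) * max (|(n : ℝ) - m| * Δt) (|(j : ℝ) - i| * Δx) := by
        rw [add_mul]
        gcongr
        exacts [le_max_left _ _, le_max_right _ _]
  obtain ⟨V, hV, heq⟩ := hlip.extend_real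
  exact ⟨V, hV, fun n j => (heq (mem_range_self (n, j))).symm.trans (hS' n j)⟩

/-- The primitive of a solution of the Godunov scheme at the node `(n Δt, j Δx)`: its increments
are `Δx` times the cell values in space and `-Δt` times the fluxes in time. The cells with index
`0` are left out, so that the nodes with `j = 0` and `j = 1` carry the same value. -/
noncomputable def godunovPotential (f : ℝ → ℝ) (Δt Δx : ℝ) (q : ℕ → ℕ → ℝ) (n j : ℕ) : ℝ :=
  ∑ i ∈ Finset.Ico 1 j, Δx * q n i - ∑ m ∈ Finset.range n, Δt * godunovFlux f (q m 0) (q m 1)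

section Potential

variable {f : ℝ → ℝ} {Δt Δx : ℝ} {q : ℕ → ℕ → ℝ}

theorem godunovPotential_space_succ (n : ℕ) {j : ℕ} (hj : 1 ≤ j) :
    godunovPotential f Δt Δx q n (j + 1) - godunovPotential f Δt Δx q n j = Δx * q n j := by
  simp only [godunovPotential, Finset.sum_Ico_succ_top hj]
  ring

theorem godunovPotential_zero_right (n : ℕ) :
    godunovPotential f Δt Δx q n 0 = godunovPotential f Δt Δx q n 1 := by
  simp only [godunovPotential, Finset.Ico_self, Finset.Ico_eq_empty_of_le zero_le_one]

theorem godunovPotential_time_succ (hΔx : Δx ≠ 0) (hq : IsGodunovSolution f Δt Δx q) (n j : ℕ) :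
    godunovPotential f Δt Δx q (n + 1) (j + 1) - godunovPotential f Δt Δx q n (j + 1) =
      -(Δt * godunovFlux f (q n j) (q n (j + 1))) := by
  induction j with
  | zero =>
    simp only [godunovPotential, zero_add, Finset.Ico_self, Finset.sum_range_succ]
    ring
  | succ j ih =>
    have hspace (m : ℕ) := godunovPotential_space_succ (f := f) (Δt := Δt) (Δx := Δx) (q := q) m
      (Nat.le_add_left 1 j)
    have hupdate : Δx * q (n + 1) (j + 1) = Δx * q n (j + 1) - Δt *
        (godunovFlux f (q n (j + 1)) (q n (j + 2)) - godunovFlux f (q n j) (q n (j + 1))) := by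
      rw [hq n j]
      field_simp
    linarith [hspace n, hspace (n + 1)]

end Potential

/-- `V` is a primitive in the second variable of the step function of `q` at the nodes of the grid,
which links the compactness of Lipschitz functions to the cell values. The cells with index `0` are
left out, as they are in `stepFunction`. -/
def IsCellPrimitive (Δt Δx : ℝ) (q : ℕ → ℕ → ℝ) (V : ℝ × ℝ → ℝ) : Prop :=
  ∀ n j : ℕ, 1 ≤ j → V (n * Δt, (j + 1 : ℕ) * Δx) - V (n * Δt, j * Δx) = Δx * q n j

theorem exists_lipschitzWith_isCellPrimitive {f : ℝ → ℝ} {Δt Δx : ℝ} {F M : ℝ≥0} {q : ℕ → ℕ → ℝ}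
    (hΔt : 0 < Δt) (hΔx : 0 < Δx) (hq : IsGodunovSolution f Δt Δx q) (hM : ∀ n j, |q n j| ≤ M)
    (hF : ∀ n j, |godunovFlux f (q n j) (q n (j + 1))| ≤ F) :
    ∃ V : C(ℝ × ℝ, ℝ), LipschitzWith (F + M) V ∧ V 0 = 0 ∧ IsCellPrimitive Δt Δx q V := by
  have htime (n j : ℕ) :
      |godunovPotential f Δt Δx q n j - godunovPotential f Δt Δx q (n + 1) j| ≤ F * Δt := by
    wlog hj : 1 ≤ j generalizing j
    · obtain rfl : j = 0 := by omega
      simpa only [godunovPotential_zero_right] using this 1 le_rfl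
    obtain ⟨i, rfl⟩ := Nat.exists_eq_add_of_le' hj
    rw [abs_sub_comm, godunovPotential_time_succ hΔx.ne' hq, abs_neg, abs_mul, abs_of_pos hΔt,
      mul_comm]
    exact mul_le_mul_of_nonneg_right (hF n i) hΔt.le
  have hspace (n j : ℕ) :
      |godunovPotential f Δt Δx q n j - godunovPotential f Δt Δx q n (j + 1)| ≤ M * Δx := by
    rcases Nat.eq_zero_or_pos j with rfl | hj
    · rw [godunovPotential_zero_right, sub_self, abs_zero]
      positivity
    · rw [abs_sub_comm, godunovPotential_space_succ n hj, abs_mul, abs_of_pos hΔx, mul_comm]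
      exact mul_le_mul_of_nonneg_right (hM n j) hΔx.le
  obtain ⟨V, hV, hVS⟩ := exists_lipschitzWith_extension_of_lattice hΔt hΔx htime hspace
  have hV₀ : V 0 = 0 := by simpa [godunovPotential, Prod.mk_zero_zero] using hVS 0 0
  refine ⟨⟨V, hV.continuous⟩, hV, hV₀, fun n j hj => ?_⟩
  rw [ContinuousMap.coe_mk, hVS, hVS, godunovPotential_space_succ n hj]

theorem isCompact_setOf_lipschitzWith {X E : Type*} [PseudoMetricSpace X] [MetricSpace E]
    [ProperSpace E] (K : ℝ≥0) (x₀ : X) (y₀ : E) :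
    IsCompact {g : C(X, E) | LipschitzWith K g ∧ g x₀ = y₀} := by
  refine ArzelaAscoli.isCompact_of_equicontinuous _ ?_
    (LipschitzWith.uniformEquicontinuous _ K fun g => g.2.1).equicontinuous
  have himage : ContinuousMap.toFun '' {g : C(X, E) | LipschitzWith K g ∧ g x₀ = y₀} =
      {g : X → E | LipschitzWith K g ∧ g x₀ = y₀} := by
    ext g
    exact ⟨fun ⟨_, hg, heq⟩ => heq ▸ hg, fun hg => ⟨⟨g, hg.1.continuous⟩, hg, rfl⟩⟩
  rw [himage]
  refine (isCompact_univ_pi fun x => isCompact_closedBall y₀ (K * dist x x₀)).of_isClosed_subset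
    ((isClosed_setOfPred_lipschitzWith K).inter
      (isClosed_singleton.preimage (continuous_apply x₀))) ?_
  rintro g ⟨hg, rfl⟩ x -
  exact hg.dist_le_mul x x₀

/-! ### Differentiating a limit of primitives -/

section OneSidedLipschitzSequences

variable {u : ℕ → ℝ} {c : ℝ}

theorem le_add_mul_of_succ_le_add (hu : ∀ j, u (j + 1) ≤ u j + c) (i m : ℕ) :
    u (i + m) ≤ u i + m * c := by
  induction m with
  | zero => simp
  | succ m ih =>
    rw [Nat.cast_succ, ← add_assoc]
    linarith [hu (i + m)]

theorem sum_range_le_mul (hc : 0 ≤ c) (hu : ∀ j, u (j + 1) ≤ u j + c) (m : ℕ) :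
    ∑ j ∈ Finset.range m, u j ≤ m * (u 0 + m * c) := by
  rw [← nsmul_eq_mul]
  refine (Finset.sum_le_card_nsmul _ _ _ fun j hj => ?_).trans_eq (by rw [Finset.card_range])
  have hle : (j : ℝ) * c ≤ m * c := by gcongr; exact (Finset.mem_range.1 hj).le
  simpa only [zero_add] using (le_add_mul_of_succ_le_add hu 0 j).trans (by gcongr)

theorem mul_le_sum_range (hc : 0 ≤ c) (hu : ∀ j, u (j + 1) ≤ u j + c) (m : ℕ) :
    m * (u m - m * c) ≤ ∑ j ∈ Finset.range m, u j := by
  rw [← nsmul_eq_mul]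
  refine le_of_eq_of_le (by rw [Finset.card_range]) (Finset.card_nsmul_le_sum _ _ _ fun j hj => ?_)
  obtain ⟨i, rfl⟩ := Nat.exists_eq_add_of_le (Finset.mem_range.1 hj).le
  have hle : (i : ℝ) * c ≤ (j + i : ℕ) * c := by gcongr; exact Nat.le_add_left i j
  linarith [le_add_mul_of_succ_le_add hu j i]

end OneSidedLipschitzSequences

section Floor

variable {ι : Type*} {l : Filter ι} {d : ι → ℝ} {t : ℝ}

theorem tendsto_floor_div_mul (hd : ∀ k, 0 < d k) (hd₀ : Tendsto d l (𝓝 0)) (ht : 0 ≤ t) :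
    Tendsto (fun k => (⌊t / d k⌋₊ : ℝ) * d k) l (𝓝 t) := by
  have hinv : Tendsto (fun k => (d k)⁻¹) l atTop := tendsto_inv_nhdsGT_zero.comp
    (tendsto_nhdsWithin_of_tendsto_nhds_of_eventually_within _ hd₀ (.of_forall hd))
  simpa only [Function.comp_def, div_inv_eq_mul, ← div_eq_mul_inv] using
    (tendsto_nat_floor_mul_div_atTop ht).comp hinv

theorem eventually_floor_div_eq {τ : ℝ} (hτ : 0 < τ) (hd : Tendsto d l (𝓝 τ)) (ht : 0 ≤ t)
    (hne : ∀ n : ℕ, t ≠ n * τ) : ∀ᶠ k in l, ⌊t / d k⌋₊ = ⌊t / τ⌋₊ := by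
  have hdiv : Tendsto (fun k => t / d k) l (𝓝 (t / τ)) := tendsto_const_nhds.div hd hτ.ne'
  have hfloor : (⌊t / τ⌋₊ : ℝ) < t / τ :=
    (Nat.floor_le (div_nonneg ht hτ.le)).lt_of_ne fun heq => hne _ ((eq_div_iff hτ.ne').1 heq).symm
  filter_upwards [hdiv.eventually_const_lt hfloor,
    hdiv.eventually_lt_const (Nat.lt_floor_add_one _)] with k hlower hupper
  exact (Nat.floor_eq_iff ((Nat.cast_nonneg _).trans hlower.le)).2 ⟨hlower.le, hupper⟩

theorem exists_tendsto_floor_div_mul (hd : ∀ k, 0 < d k) {τ : ℝ} (hτ : 0 ≤ τ)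
    (hdτ : Tendsto d l (𝓝 τ)) (ht : 0 ≤ t) (hne : ∀ n : ℕ, t ≠ n * τ) :
    ∃ s, Tendsto (fun k => (⌊t / d k⌋₊ : ℝ) * d k) l (𝓝 s) := by
  rcases hτ.eq_or_lt with rfl | hτ
  · exact ⟨t, tendsto_floor_div_mul hd hdτ ht⟩
  · refine ⟨_, (hdτ.const_mul (⌊t / τ⌋₊ : ℝ)).congr' ?_⟩
    filter_upwards [eventually_floor_div_eq hτ hdτ ht hne] with k hk
    rw [hk]

end Floor

section Derivative

variable {ι : Type*} {l : Filter ι} {d : ι → ℝ} {G : ι → C(ℝ, ℝ)} {g : C(ℝ, ℝ)} {a : ι → ℕ → ℝ}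
  {x₀ x C c h D : ℝ}

/-- By the one-sided bound `a k` varies upwards by at most `h * C` on a window of length `h`, so
its value at `x` is bounded below by its mean to the right of `x` and above by its mean to the
left; these means are difference quotients of `G k`. -/
theorem eventually_lt_of_lt_slope (hd : ∀ k, 0 < d k) (hd₀ : Tendsto d l (𝓝 0))
    (hG : Tendsto G l (𝓝 g))
    (hGa : ∀ k (j : ℕ), x₀ ≤ j * d k → G k ((j + 1 : ℕ) * d k) - G k (j * d k) = d k * a k j)
    (hC : 0 ≤ C) (ha : ∀ᶠ k in l, ∀ j : ℕ, x₀ ≤ j * d k → a k (j + 1) ≤ a k j + d k * C)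
    (hx : 0 ≤ x) (hx₀ : x₀ < x) (hh : 0 < h) (hc : c < (g (x + h) - g x) / h - h * C) :
    ∀ᶠ k in l, c < a k ⌊x / d k⌋₊ := by
  have hJ := tendsto_floor_div_mul hd hd₀ hx
  have hm := tendsto_floor_div_mul hd hd₀ hh.le
  have hquot := (((hG.eval (hJ.add hm)).sub (hG.eval hJ)).div hm hh.ne').sub (hm.mul_const C)
  filter_upwards [ha, hquot.eventually_const_lt hc, hJ.eventually_const_lt hx₀,
    hm.eventually_const_lt hh] with k hak hk hx₀k hmk
  simp only [Pi.div_apply] at hk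
  set J := ⌊x / d k⌋₊
  set m := ⌊h / d k⌋₊
  have hright (j : ℕ) : x₀ ≤ (J + j : ℕ) * d k :=
    hx₀k.le.trans (by gcongr; exacts [(hd k).le, Nat.le_add_right J j])
  have hsum := Finset.sum_range_sub (fun j => G k ((J + j : ℕ) * d k)) m
  have hincr (j : ℕ) := hGa k (J + j) (hright j)
  simp only [← add_assoc, hincr, ← Finset.mul_sum, add_zero] at hsum
  have hle := mul_le_mul_of_nonneg_left (sum_range_le_mul (u := fun j => a k (J + j))
    (mul_nonneg (hd k).le hC) (fun j => hak _ (hright j)) m) (hd k).le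
  refine hk.trans_le (sub_le_iff_le_add.2 ((div_le_iff₀ hmk).2 ?_))
  rw [← add_mul, ← Nat.cast_add, ← hsum]
  rw [add_zero] at hle
  linarith

theorem eventually_lt_of_slope_lt (hd : ∀ k, 0 < d k) (hd₀ : Tendsto d l (𝓝 0))
    (hG : Tendsto G l (𝓝 g))
    (hGa : ∀ k (j : ℕ), x₀ ≤ j * d k → G k ((j + 1 : ℕ) * d k) - G k (j * d k) = d k * a k j)
    (hC : 0 ≤ C) (ha : ∀ᶠ k in l, ∀ j : ℕ, x₀ ≤ j * d k → a k (j + 1) ≤ a k j + d k * C)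
    (hx : 0 ≤ x - h) (hx₀ : x₀ < x - h) (hh : 0 < h) (hc : (g x - g (x - h)) / h + h * C < c) :
    ∀ᶠ k in l, a k ⌊x / d k⌋₊ < c := by
  have hJ := tendsto_floor_div_mul hd hd₀ (by linarith : 0 ≤ x)
  have hm := tendsto_floor_div_mul hd hd₀ hh.le
  have hquot := (((hG.eval hJ).sub (hG.eval (hJ.sub hm))).div hm hh.ne').add (hm.mul_const C)
  filter_upwards [ha, hquot.eventually_lt_const hc, (hJ.sub hm).eventually_const_lt hx₀,
    hm.eventually_const_lt hh] with k hak hk hx₀k hmk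
  simp only [Pi.div_apply] at hk
  have hmJ : ⌊h / d k⌋₊ ≤ ⌊x / d k⌋₊ := Nat.floor_mono (by gcongr; exacts [(hd k).le, by linarith])
  obtain ⟨i, hi⟩ := Nat.exists_eq_add_of_le' hmJ
  set m := ⌊h / d k⌋₊
  rw [hi, Nat.cast_add, add_mul, add_sub_cancel_right] at hk hx₀k
  rw [hi]
  have hright (j : ℕ) : x₀ ≤ (i + j : ℕ) * d k :=
    hx₀k.le.trans (by gcongr; exacts [(hd k).le, Nat.le_add_right i j])
  have hsum := Finset.sum_range_sub (fun j => G k ((i + j : ℕ) * d k)) m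
  have hincr (j : ℕ) := hGa k (i + j) (hright j)
  simp only [← add_assoc, hincr, ← Finset.mul_sum, add_zero] at hsum
  have hle := mul_le_mul_of_nonneg_left (mul_le_sum_range (u := fun j => a k (i + j))
    (mul_nonneg (hd k).le hC) (fun j => hak _ (hright j)) m) (hd k).le
  refine lt_of_le_of_lt (sub_le_iff_le_add.1 ((le_div_iff₀ hmk).2 ?_)) hk
  rw [← add_mul, ← Nat.cast_add, ← hsum]
  linarith

theorem tendsto_of_hasDerivAt_of_oneSidedLipschitz (hd : ∀ k, 0 < d k) (hd₀ : Tendsto d l (𝓝 0))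
    (hG : Tendsto G l (𝓝 g))
    (hGa : ∀ k (j : ℕ), x₀ ≤ j * d k → G k ((j + 1 : ℕ) * d k) - G k (j * d k) = d k * a k j)
    (hC : 0 ≤ C) (ha : ∀ᶠ k in l, ∀ j : ℕ, x₀ ≤ j * d k → a k (j + 1) ≤ a k j + d k * C)
    (hx : 0 < x) (hx₀ : x₀ < x) (hD : HasDerivAt g D x) :
    Tendsto (fun k => a k ⌊x / d k⌋₊) l (𝓝 D) := by
  refine tendsto_order.2 ⟨fun c hc => ?_, fun c hc => ?_⟩
  · have hslope : Tendsto (fun h => h⁻¹ • (g (x + h) - g x) - h * C) (𝓝[>] 0) (𝓝 D) := by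
      simpa using hD.tendsto_slope_zero_right.sub
        ((tendsto_id.mono_left nhdsWithin_le_nhds).mul_const C)
    obtain ⟨h, hch, hh⟩ := ((hslope.eventually_const_lt hc).and self_mem_nhdsWithin).exists
    rw [smul_eq_mul, inv_mul_eq_div] at hch
    exact eventually_lt_of_lt_slope hd hd₀ hG hGa hC ha hx.le hx₀ hh hch
  · have hneg : Tendsto (fun h : ℝ => -h) (𝓝[>] 0) (𝓝[<] 0) := by
      simpa using tendsto_neg_nhdsGT (a := (0 : ℝ))
    have hslope : Tendsto (fun h => (g x - g (x - h)) / h + h * C) (𝓝[>] 0) (𝓝 D) := by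
      have := (hD.tendsto_slope_zero_left.comp hneg).add
        ((tendsto_id.mono_left nhdsWithin_le_nhds).mul_const C)
      simpa [Function.comp_def, inv_mul_eq_div, div_neg, ← neg_div, ← sub_eq_add_neg] using this
    have hnear : ∀ᶠ h in 𝓝[>] (0 : ℝ), h < x ∧ h < x - x₀ :=
      nhdsWithin_le_nhds ((eventually_lt_nhds hx).and (eventually_lt_nhds (sub_pos.2 hx₀)))
    obtain ⟨h, ⟨hch, hhx, hhx₀⟩, hh⟩ :=
      (((hslope.eventually_lt_const hc).and hnear).and self_mem_nhdsWithin).exists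
    exact eventually_lt_of_slope_lt hd hd₀ hG hGa hC ha (by linarith) (by linarith) hh hch

end Derivative

/-! ### Convergence of the step functions -/

section StepFunction

theorem measurable_stepFunction (Δt Δx : ℝ) (q : ℕ → ℕ → ℝ) :
    Measurable (stepFunction Δt Δx q) := by
  have hcell : Measurable fun z : ℝ × ℝ => (⌊z.1 / Δt⌋₊, ⌊z.2 / Δx⌋₊) := by fun_prop
  refine Measurable.ite ?_ ((measurable_of_countable fun p : ℕ × ℕ => q p.1 p.2).comp hcell)
    measurable_const
  exact (measurableSet_le measurable_const measurable_fst).inter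
    (measurableSet_le measurable_const measurable_snd)

theorem abs_stepFunction_le {Δt Δx M : ℝ} {q : ℕ → ℕ → ℝ} (hq : ∀ n j, |q n j| ≤ M) (z : ℝ × ℝ) :
    |stepFunction Δt Δx q z| ≤ M := by
  unfold stepFunction
  split_ifs
  · exact hq _ _
  · exact abs_zero.trans_le ((abs_nonneg _).trans (hq 0 0))

variable {ι : Type*} {l : Filter ι} {Δt Δx : ι → ℝ} {q : ι → ℕ → ℕ → ℝ} {V : ι → C(ℝ × ℝ, ℝ)}
  {W : C(ℝ × ℝ, ℝ)} {A B t x ξ D : ℝ}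

theorem tendsto_stepFunction_of_steps_tendsto_atTop (hΔx : Tendsto Δx l atTop) (z : ℝ × ℝ) :
    Tendsto (fun k => stepFunction (Δt k) (Δx k) (q k) z) l (𝓝 0) := by
  refine tendsto_const_nhds.congr' ?_
  filter_upwards [hΔx.eventually_gt_atTop z.2] with k hk
  rw [stepFunction, if_neg fun h => hk.not_ge h.2]

theorem exists_tendsto_stepFunction_of_steps_tendsto_pos (hΔx : ∀ k, 0 < Δx k) (hξ : 0 < ξ)
    (hΔxξ : Tendsto Δx l (𝓝 ξ)) (hprim : ∀ k, IsCellPrimitive (Δt k) (Δx k) (q k) (V k))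
    (hV : Tendsto V l (𝓝 W)) (ht : 0 ≤ t) (hx : 0 ≤ x) {s : ℝ}
    (hs : Tendsto (fun k => (⌊t / Δt k⌋₊ : ℝ) * Δt k) l (𝓝 s)) (hne : ∀ n : ℕ, x ≠ n * ξ) :
    ∃ r, Tendsto (fun k => stepFunction (Δt k) (Δx k) (q k) (t, x)) l (𝓝 r) := by
  have hfloor := eventually_floor_div_eq hξ hΔxξ hx hne
  rcases Nat.eq_zero_or_pos ⌊x / ξ⌋₊ with hj | hj
  · refine ⟨0, tendsto_const_nhds.congr' ?_⟩
    filter_upwards [hfloor] with k hk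
    rw [hj, Nat.floor_eq_zero, div_lt_one (hΔx k)] at hk
    rw [stepFunction, if_neg fun h => hk.not_ge h.2]
  · have hnode (i : ℕ) := hV.eval (hs.prodMk_nhds (hΔxξ.const_mul (i : ℝ)))
    refine ⟨_, (((hnode (⌊x / ξ⌋₊ + 1)).sub (hnode ⌊x / ξ⌋₊)).div hΔxξ hξ.ne').congr' ?_⟩
    filter_upwards [hfloor] with k hk
    have hle : Δx k ≤ x := by rwa [← one_le_div (hΔx k), ← Nat.one_le_floor_iff, hk]
    rw [Pi.div_apply, hprim k _ _ hj, mul_div_cancel_left₀ _ (hΔx k).ne', stepFunction,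
      if_pos ⟨ht, hle⟩, hk]

theorem tendsto_stepFunction_of_hasDerivAt (hΔt : ∀ k, 0 < Δt k) (hΔx : ∀ k, 0 < Δx k)
    (hΔt₀ : Tendsto Δt l (𝓝 0)) (hΔx₀ : Tendsto Δx l (𝓝 0)) (hA : 0 ≤ A) (hB : 0 ≤ B)
    (hO : ∀ k, HasOleinikBound (Δt k) (Δx k) A B (q k))
    (hprim : ∀ k, IsCellPrimitive (Δt k) (Δx k) (q k) (V k)) (hV : Tendsto V l (𝓝 W))
    (ht : 0 < t) (hx : 0 < x) (hD : HasDerivAt (fun y => W (t, y)) D x) :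
    Tendsto (fun k => stepFunction (Δt k) (Δx k) (q k) (t, x)) l (𝓝 D) := by
  have htime := tendsto_floor_div_mul hΔt hΔt₀ ht.le
  have hslice : Tendsto (fun k => (V k).curry (⌊t / Δt k⌋₊ * Δt k)) l (𝓝 (W.curry t)) :=
    ((ContinuousMap.continuous_curry.tendsto W).comp hV).eval htime
  have hpos {k} {j : ℕ} (hj : x / 2 ≤ j * Δx k) : 1 ≤ j :=
    Nat.cast_pos.1 (pos_of_mul_pos_left ((half_pos hx).trans_le hj) (hΔx k).le)
  have hincr : ∀ᶠ k in l, ∀ j : ℕ, x / 2 ≤ j * Δx k →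
      q k ⌊t / Δt k⌋₊ (j + 1) ≤ q k ⌊t / Δt k⌋₊ j + Δx k * (A / (t / 2) + B / (x / 2)) := by
    filter_upwards [htime.eventually_const_lt (half_lt_self ht)] with k hk j hj
    have hn := Nat.cast_pos.1 (pos_of_mul_pos_left ((half_pos ht).trans hk) (hΔt k).le)
    refine sub_le_iff_le_add'.1 ((hO k _ j hn (hpos hj)).trans ?_)
    gcongr
    exact (hΔx k).le
  refine (tendsto_of_hasDerivAt_of_oneSidedLipschitz hΔx hΔx₀ hslice
    (fun k j hj => hprim k _ j (hpos hj)) (by positivity) hincr hx (half_lt_self hx) hD).congr' ?_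
  filter_upwards [hΔx₀.eventually_le_const hx] with k hk
  rw [stepFunction, if_pos ⟨ht.le, hk⟩]

theorem ae_exists_tendsto_stepFunction_of_steps_tendsto_zero (hΔt : ∀ k, 0 < Δt k)
    (hΔx : ∀ k, 0 < Δx k) (hΔt₀ : Tendsto Δt l (𝓝 0)) (hΔx₀ : Tendsto Δx l (𝓝 0)) (hA : 0 ≤ A)
    (hB : 0 ≤ B) (hO : ∀ k, HasOleinikBound (Δt k) (Δx k) A B (q k))
    (hprim : ∀ k, IsCellPrimitive (Δt k) (Δx k) (q k) (V k)) (hV : Tendsto V l (𝓝 W)) {K : ℝ≥0}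
    (hW : LipschitzWith K W) :
    ∀ᵐ z ∂(volume.restrict (Ioi (0 : ℝ) ×ˢ Ioi (0 : ℝ))),
      ∃ r, Tendsto (fun k => stepFunction (Δt k) (Δx k) (q k) z) l (𝓝 r) := by
  rw [ae_restrict_iff' (measurableSet_Ioi.prod measurableSet_Ioi)]
  filter_upwards [hW.ae_differentiableAt] with ⟨t, x⟩ hdiff ⟨ht, hx⟩
  exact ⟨_, tendsto_stepFunction_of_hasDerivAt hΔt hΔx hΔt₀ hΔx₀ hA hB hO hprim hV ht hx
    (hdiff.hasFDerivAt.comp_hasDerivAt x ((hasDerivAt_const x t).prodMk (hasDerivAt_id x)))⟩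

theorem ae_ne_nat_mul (a : ℝ) : ∀ᵐ x : ℝ, ∀ n : ℕ, x ≠ n * a :=
  ae_all_iff.2 fun n => Measure.ae_ne volume (n * a)

theorem ae_exists_tendsto_stepFunction_of_steps_tendsto_pos (hΔt : ∀ k, 0 < Δt k)
    (hΔx : ∀ k, 0 < Δx k) {τ : ℝ} (hτ : 0 ≤ τ) (hΔtτ : Tendsto Δt l (𝓝 τ)) (hξ : 0 < ξ)
    (hΔxξ : Tendsto Δx l (𝓝 ξ)) (hprim : ∀ k, IsCellPrimitive (Δt k) (Δx k) (q k) (V k))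
    (hV : Tendsto V l (𝓝 W)) :
    ∀ᵐ z ∂(volume.restrict (Ioi (0 : ℝ) ×ˢ Ioi (0 : ℝ))),
      ∃ r, Tendsto (fun k => stepFunction (Δt k) (Δx k) (q k) z) l (𝓝 r) := by
  rw [ae_restrict_iff' (measurableSet_Ioi.prod measurableSet_Ioi), Measure.volume_eq_prod]
  filter_upwards [Measure.quasiMeasurePreserving_fst.ae (ae_ne_nat_mul τ),
    Measure.quasiMeasurePreserving_snd.ae (ae_ne_nat_mul ξ)] with ⟨t, x⟩ htτ hxξ ⟨ht, hx⟩
  obtain ⟨s, hs⟩ := exists_tendsto_floor_div_mul hΔt hτ hΔtτ (le_of_lt ht) htτ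
  exact exists_tendsto_stepFunction_of_steps_tendsto_pos hΔx hξ hΔxξ hprim hV (le_of_lt ht)
    (le_of_lt hx) hs hxξ

end StepFunction

theorem exists_subseq_tendsto_steps {Δt Δx : ℕ → ℝ} {C : ℝ} (hΔt : ∀ k, 0 < Δt k)
    (hΔx : ∀ k, 0 < Δx k) (hC : ∀ k, Δt k ≤ C * Δx k) :
    ∃ φ : ℕ → ℕ, StrictMono φ ∧ (Tendsto (Δx ∘ φ) atTop atTop ∨
      (Tendsto (Δt ∘ φ) atTop (𝓝 0) ∧ Tendsto (Δx ∘ φ) atTop (𝓝 0)) ∨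
      ∃ τ ξ : ℝ, 0 ≤ τ ∧ 0 < ξ ∧ Tendsto (Δt ∘ φ) atTop (𝓝 τ) ∧
        Tendsto (Δx ∘ φ) atTop (𝓝 ξ)) := by
  by_cases hbdd : ∃ R, ∃ᶠ k in atTop, Δx k ≤ R
  · obtain ⟨R, hR⟩ := hbdd
    have hC₀ : 0 ≤ C := nonneg_of_mul_nonneg_left ((hΔt 0).le.trans (hC 0)) (hΔx 0)
    obtain ⟨⟨τ, ξ⟩, -, φ, hφ, hlim⟩ :=
      (isCompact_Icc (a := ((0 : ℝ), (0 : ℝ))) (b := (C * R, R))).tendsto_subseq'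
        (x := fun k => (Δt k, Δx k)) (hR.mono fun k hk => ⟨⟨(hΔt k).le, (hΔx k).le⟩,
          (hC k).trans (mul_le_mul_of_nonneg_left hk hC₀), hk⟩)
    have hτ : Tendsto (Δt ∘ φ) atTop (𝓝 τ) := hlim.fst_nhds
    have hξ : Tendsto (Δx ∘ φ) atTop (𝓝 ξ) := hlim.snd_nhds
    have hτ₀ : 0 ≤ τ := ge_of_tendsto' hτ fun k => (hΔt _).le
    have hξ₀ : 0 ≤ ξ := ge_of_tendsto' hξ fun k => (hΔx _).le
    refine ⟨φ, hφ, .inr ?_⟩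
    rcases hξ₀.eq_or_lt with rfl | hξ₀
    · have hτ_le : τ ≤ C * 0 := le_of_tendsto_of_tendsto' hτ (hξ.const_mul C) fun k => hC _
      obtain rfl : τ = 0 := le_antisymm (by simpa using hτ_le) hτ₀
      exact .inl ⟨hτ, hξ⟩
    · exact .inr ⟨τ, ξ, hτ₀, hξ₀, hτ, hξ⟩
  · push Not at hbdd
    exact ⟨id, strictMono_id, .inl (tendsto_atTop.2 fun R => (hbdd R).mono fun k hk => hk.le)⟩

theorem exists_subseq_ae_tendsto_stepFunction {Δt Δx : ℕ → ℝ} {q : ℕ → ℕ → ℕ → ℝ}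
    {V : ℕ → C(ℝ × ℝ, ℝ)} {K : ℝ≥0} {A B C M : ℝ} (hΔt : ∀ k, 0 < Δt k) (hΔx : ∀ k, 0 < Δx k)
    (hC : ∀ k, Δt k ≤ C * Δx k) (hM : ∀ k n j, |q k n j| ≤ M) (hA : 0 ≤ A) (hB : 0 ≤ B)
    (hO : ∀ k, HasOleinikBound (Δt k) (Δx k) A B (q k)) (hV : ∀ k, LipschitzWith K (V k))
    (hV₀ : ∀ k, V k 0 = 0) (hprim : ∀ k, IsCellPrimitive (Δt k) (Δx k) (q k) (V k)) :
    ∃ (φ : ℕ → ℕ) (ρ : ℝ × ℝ → ℝ),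
      StrictMono φ ∧
      MemLp ρ ∞ (volume.restrict (Ioi (0 : ℝ) ×ˢ Ioi (0 : ℝ))) ∧
      ∀ᵐ z ∂(volume.restrict (Ioi (0 : ℝ) ×ˢ Ioi (0 : ℝ))),
        Tendsto (fun k => stepFunction (Δt (φ k)) (Δx (φ k)) (q (φ k)) z) atTop (𝓝 (ρ z)) := by
  obtain ⟨W, ⟨hW, -⟩, φ, hφ, hlim⟩ :=
    (isCompact_setOf_lipschitzWith K (0 : ℝ × ℝ) (0 : ℝ)).tendsto_subseq fun k => ⟨hV k, hV₀ k⟩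
  obtain ⟨ψ, hψ, hsteps⟩ := exists_subseq_tendsto_steps (fun k => hΔt (φ k)) (fun k => hΔx (φ k))
    fun k => hC (φ k)
  have hlim := hlim.comp hψ.tendsto_atTop
  have hae : ∀ᵐ z ∂(volume.restrict (Ioi (0 : ℝ) ×ˢ Ioi (0 : ℝ))), ∃ r, Tendsto
      (fun k => stepFunction (Δt (φ (ψ k))) (Δx (φ (ψ k))) (q (φ (ψ k))) z) atTop (𝓝 r) := by
    rcases hsteps with hinf | ⟨hΔt₀, hΔx₀⟩ | ⟨τ, ξ, hτ, hξ, hΔtτ, hΔxξ⟩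
    · exact .of_forall fun z => ⟨0, tendsto_stepFunction_of_steps_tendsto_atTop hinf z⟩
    · exact ae_exists_tendsto_stepFunction_of_steps_tendsto_zero (fun k => hΔt _) (fun k => hΔx _)
        hΔt₀ hΔx₀ hA hB (fun k => hO _) (fun k => hprim _) hlim hW
    · exact ae_exists_tendsto_stepFunction_of_steps_tendsto_pos (fun k => hΔt _) (fun k => hΔx _)
        hτ hΔtτ hξ hΔxξ (fun k => hprim _) hlim
  obtain ⟨ρ, hρm, hρ⟩ := measurable_limit_of_tendsto_metrizable_ae
    (fun k => (measurable_stepFunction _ _ _).aemeasurable) hae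
  refine ⟨φ ∘ ψ, ρ, hφ.comp hψ, memLp_top_of_bound hρm.aestronglyMeasurable M ?_, hρ⟩
  filter_upwards [hρ] with z hz
  exact le_of_tendsto' hz.norm fun k => abs_stepFunction_le (hM _) z

theorem proposition6p2_general
    {f : ℝ → ℝ} {δ a b : ℝ} {L : ℝ≥0} (hab : a < b) (hδ : 0 < δ)
    (hf : StrongConvexOn (Icc a b) δ f) (hL : LipschitzOnWith L f (Icc a b))
    {Δt Δx : ℕ → ℝ} (hΔt : ∀ k, 0 < Δt k) (hΔx : ∀ k, 0 < Δx k)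
    (hCFL : ∀ k, 2 * (L : ℝ) ≤ Δx k / Δt k) {q : ℕ → ℕ → ℕ → ℝ}
    (hq : ∀ k, IsGodunovSolution f (Δt k) (Δx k) (q k)) (hmem : ∀ k n j, q k n j ∈ Icc a b) :
    ∃ (φ : ℕ → ℕ) (ρ : ℝ × ℝ → ℝ),
      StrictMono φ ∧
      MemLp ρ ∞ (volume.restrict (Ioi (0 : ℝ) ×ˢ Ioi (0 : ℝ))) ∧
      ∀ᵐ z ∂(volume.restrict (Ioi (0 : ℝ) ×ˢ Ioi (0 : ℝ))),
        Tendsto (fun k => stepFunction (Δt (φ k)) (Δx (φ k)) (q (φ k)) z) atTop (𝓝 (ρ z)) := by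
  obtain ⟨θ, h⟩ := exists_isStronglyConvexFlux hab.le hδ hf hL
  obtain ⟨F, hF⟩ := isCompact_Icc.exists_bound_of_continuousOn hL.continuousOn
  have hM (k n j) : |q k n j| ≤ max |a| |b| := abs_le_max_abs_abs (hmem k n j).1 (hmem k n j).2
  have hflux (k n j) : |godunovFlux f (q k n j) (q k n (j + 1))| ≤ F.toNNReal :=
    (h.isUnimodalOn.abs_godunovFlux_le hF (hmem k n j) (hmem k n (j + 1))).trans
      (Real.le_coe_toNNReal F)
  choose V hV hV₀ hprim using fun k => exists_lipschitzWith_isCellPrimitive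
    (M := ⟨max |a| |b|, by positivity⟩) (hΔt k) (hΔx k) (hq k) (hM k) (hflux k)
  have hLpos : (0 : ℝ) < L := by
    linarith [h.mul_sub_le_four_mul, mul_pos hδ (sub_pos.2 hab)]
  have hratio (k) : Δt k ≤ (2 * (L : ℝ))⁻¹ * Δx k := by
    rw [le_inv_mul_iff₀ (by positivity), ← le_div_iff₀ (hΔt k)]
    exact hCFL k
  exact exists_subseq_ae_tendsto_stepFunction hΔt hΔx hratio hM (by positivity) (by positivity)
    (fun k => h.hasOleinikBound (hΔt k) (hΔx k) (hCFL k) (hq k) (hmem k)) hV hV₀ hprim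

theorem proposition6p2
    (f : ℝ → ℝ) (δ M : ℝ) (L : ℝ≥0)
    (hf : ContDiff ℝ 2 f) (hδ : 0 < δ) (hM : 0 < M)
    (hconv : ∀ x ∈ Icc (-M) M, δ ≤ deriv (deriv f) x)
    (hL : LipschitzOnWith L f (Icc (-M) M))
    (Δt Δx : ℕ → ℝ) (hΔt : ∀ k, 0 < Δt k) (hΔx : ∀ k, 0 < Δx k)
    (hCFL₁ : ∀ k, 2 * (L : ℝ) ≤ Δx k / Δt k)
    (hCFL₂ : ∀ k, Δt k / Δx k * (δ / 2) * M ≤ 1)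
    (q : ℕ → ℕ → ℕ → ℝ)
    (hq : ∀ k, IsGodunovSolution f (Δt k) (Δx k) (q k))
    (hbound : ∀ k n j, |q k n j| ≤ M) :
    ∃ (φ : ℕ → ℕ) (ρ : ℝ × ℝ → ℝ),
      StrictMono φ ∧
      MemLp ρ ∞ (volume.restrict (Ioi (0 : ℝ) ×ˢ Ioi (0 : ℝ))) ∧
      ∀ᵐ z ∂(volume.restrict (Ioi (0 : ℝ) ×ˢ Ioi (0 : ℝ))),
        Tendsto (fun k => stepFunction (Δt (φ k)) (Δx (φ k)) (q (φ k)) z) atTop (𝓝 (ρ z)) := by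
  exact proposition6p2_general (neg_lt_self hM) hδ
    (strongConvexOn_of_le_deriv2 (convex_Icc _ _) hf hconv) hL hΔt hΔx hCFL₁ hq
    fun k n j => abs_le.1 (hbound k n j)
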